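/- \textbf{Proposition (Difference between the ETO and WETO resource theories).} Let $\Omega$ be a finite set and let $d$ be a probability distribution over $\Omega$ with $d_i>0$ for all $i\in\Omega$. For $i,j\in\Omega$ with $i\neq j$ and $d_i\ge d_j$, the $d$-swap $P^d(i,j)$ is the real $\Omega\times\Omega$ matrix that agrees with the identity except that $$P^d(i,j)_{i,i}=1-\gamma,\qquad P^d(i,j)_{i,j}=1,\qquad P^d(i,j)_{j,i}=\gamma,\qquad P^d(i,j)_{j,j}=0,\qquad \gamma=\frac{d_j}{d_i};$$ the identity matrix $\mathbb I$ is also counted as a $d$-swap. A $T^d$-transform is a matrix $(1-\lambda)\mathbb I+\lambda P$ with $P$ a $d$-swap and $0\le\lambda\le1$. The resource theory $\mathrm{RT}_{\mathrm{ETO}}(d)$ of (strong) elementary thermal operations is the set of pairs $(p,q)$ of probability distributions over $\Omega$ such that $q=Mp$ for some convex combination $M$ of finite products of $d$-swaps. The resource theory $\mathrm{RT}_{\mathrm{WETO}}(d)$ of weak elementary thermal operations is the set of pairs $(p,q)$ of probability distributions over $\Omega$ such that $q=Mp$ for some finite product $M$ of $T^d$-transforms. If $\mathrm{RT}_{\mathrm{ETO}}(d)=\mathrm{RT}_{\mathrm{WETO}}(d)$,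 then $d$ is quasi-uniform, that is, there are $x,y\in\mathbb R$ with $d_i\in\{x,y\}$ for all $i\in\Omega$. -/

import Mathlib

namespace ThermalOps

variable {Ω : Type*} [DecidableEq Ω]

/-- The matrix `[[1 - γ, 1], [γ, 0]] ⊕ 𝕀` with `γ = d j / d i`, the `2 × 2` block being placed in the
rows and columns `i, j` (in this order). For `i = j` it is the identity. -/
noncomputable def swapMatrix (d : Ω → ℝ) (i j : Ω) : Matrix Ω Ω ℝ :=
  if i = j then 1 else
    Matrix.of fun k l =>
      if k = i ∧ l = i then 1 - d j / d i
      else if k = i ∧ l = j then 1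
      else if k = j ∧ l = i then d j / d i
      else if k = j ∧ l = j then 0
      else if k = l then 1 else 0

/-- `M` is a `d`-swap `P^d(i, j) = Qᵀ P^{d↓}(i, j) Q` with `i ≤ j`. The permutation `Q` that sorts `d`
is given by an enumeration `e` of `Ω` along which `d` is non-increasing, so that `d ∘ e` is `d↓`, and
conjugation by `Q` is the reindexing of matrices along `e`. -/
def IsDSwap [Fintype Ω] (d : Ω → ℝ) (M : Matrix Ω Ω ℝ) : Prop :=
  ∃ e : Fin (Fintype.card Ω) ≃ Ω, Antitone (d ∘ e) ∧
    ∃ i j : Fin (Fintype.card Ω), i ≤ j ∧ M = Matrix.reindex e e (swapMatrix (d ∘ e) i j)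

/-- `M` is a `T^d`-transform: `M = (1 - t) 𝕀 + t P` with `0 ≤ t ≤ 1` and `P` a `d`-swap. -/
def IsTTransform [Fintype Ω] (d : Ω → ℝ) (M : Matrix Ω Ω ℝ) : Prop :=
  ∃ P : Matrix Ω Ω ℝ, IsDSwap d P ∧ ∃ t : ℝ, 0 ≤ t ∧ t ≤ 1 ∧
    M = (1 - t) • (1 : Matrix Ω Ω ℝ) + t • P

/-- The polytope of weak elementary thermal operations: all finite products of `T^d`-transforms. -/
def polytopeWETO [Fintype Ω] (d : Ω → ℝ) : Set (Matrix Ω Ω ℝ) :=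
  (Submonoid.closure {M : Matrix Ω Ω ℝ | IsTTransform d M} : Set (Matrix Ω Ω ℝ))

/-- The polytope of strong elementary thermal operations: all convex combinations of finite products
of `d`-swaps. -/
def polytopeETO [Fintype Ω] (d : Ω → ℝ) : Set (Matrix Ω Ω ℝ) :=
  convexHull ℝ (Submonoid.closure {M : Matrix Ω Ω ℝ | IsDSwap d M} : Set (Matrix Ω Ω ℝ))

/-- The transformations `p ↦ q` between probability distributions over `Ω` that can be realised by
applying one of the matrices in `S`. -/
def transformations [Fintype Ω] (S : Set (Matrix Ω Ω ℝ)) : Set ((Ω → ℝ) × (Ω → ℝ)) :=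
  {x | x.1 ∈ stdSimplex ℝ Ω ∧ x.2 ∈ stdSimplex ℝ Ω ∧ ∃ M ∈ S, x.2 = M.mulVec x.1}

/-- The resource theory of weak elementary thermal operations. -/
def resourceTheoryWETO [Fintype Ω] (d : Ω → ℝ) : Set ((Ω → ℝ) × (Ω → ℝ)) :=
  transformations (polytopeWETO d)

/-- The resource theory of strong elementary thermal operations. -/
def resourceTheoryETO [Fintype Ω] (d : Ω → ℝ) : Set ((Ω → ℝ) × (Ω → ℝ)) :=
  transformations (polytopeETO d)

/-- `d` is quasi-uniform: its entries take at most two different values. -/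
def IsQuasiUniform {Ω : Type*} (d : Ω → ℝ) : Prop :=
  ∃ x y : ℝ, ∀ i, d i = x ∨ d i = y

theorem reindex_swapMatrix {ι : Type*} [DecidableEq ι] (d : Ω → ℝ) (e : ι ≃ Ω) (i j : ι) :
    Matrix.reindex e e (swapMatrix (d ∘ e) i j) = swapMatrix d (e i) (e j) := by
  by_cases h : i = j
  · subst h
    simp [swapMatrix]
  · ext a b
    simp [swapMatrix, h, Equiv.symm_apply_eq]

theorem swapMatrix_comm_of_eq (d : Ω → ℝ) {i j : Ω} (hi : d i ≠ 0) (h : d i = d j) :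
    swapMatrix d i j = swapMatrix d j i := by
  by_cases hij : i = j
  · subst hij
    rfl
  · ext a b
    have hj : d j ≠ 0 := h ▸ hi
    simp only [swapMatrix, hij, Ne.symm hij, if_false, Matrix.of_apply, h, div_self hj, sub_self]
    by_cases h1 : a = i <;> by_cases h2 : b = i <;> by_cases h3 : a = j <;> by_cases h4 : b = j <;>
      simp_all

/-- For positive `d`, the `d`-swaps are the matrices `swapMatrix d a b` with `d b ≤ d a`. -/
theorem isDSwap_iff [Fintype Ω] {d : Ω → ℝ} (hd : ∀ i, 0 < d i) (M : Matrix Ω Ω ℝ) :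
    IsDSwap d M ↔ ∃ a b : Ω, d b ≤ d a ∧ M = swapMatrix d a b := by
  constructor
  · rintro ⟨e, he, i, j, hij, rfl⟩
    exact ⟨e i, e j, he hij, reindex_swapMatrix d e i j⟩
  · rintro ⟨a, b, hab, rfl⟩
    obtain ⟨e, he⟩ : ∃ e : Fin (Fintype.card Ω) ≃ Ω, Antitone (d ∘ e) := by
      let e0 := (Fintype.equivFin Ω).symm
      refine ⟨(Tuple.sort (fun k => -d (e0 k))).trans e0, fun k l hkl => ?_⟩
      have := Tuple.monotone_sort (fun k => -d (e0 k)) hkl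
      simpa using this
    obtain ⟨i, rfl⟩ := e.surjective a
    obtain ⟨j, rfl⟩ := e.surjective b
    rcases le_total i j with hij | hij
    · exact ⟨e, he, i, j, hij, (reindex_swapMatrix d e i j).symm⟩
    · refine ⟨e, he, j, i, hij, ?_⟩
      rw [reindex_swapMatrix]
      exact swapMatrix_comm_of_eq d (hd _).ne' (le_antisymm (he hij) hab)

end ThermalOps

/-! By contraposition, take `d z < d y < d x` and put β = d y / d x, γ = d z / d y, α = βγ. In the
ratios p k / d k a swap is (r_i, r_j) ↦ ((1 - g) r_i + g r_j, r_i) with g = d j / d i, so adding a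
constant to all ratios of the three levels commutes with swaps among them. Start from ratios
proportional to 1 + (1, 0, t) on x, y, z and 0 elsewhere. Two products of swaps, A and B, send p to
the ends of an edge of a polytope (`InRegion`) which is invariant under all swaps of the three
levels; the midpoint of the edge is an ETO image of p.

It is not a WETO image. The lower bound on u is attained at Ap, the bound v ≤ 1 at Bp, and `face_le`
is an equality at both. A swapped point on this face has v = 1 or minimal u: the 12-swap misses the
face, the 13-swap meets it only with v = 1, the 23-swap only with minimal u. Each of the last two
keeps that coordinate fixed, so a partial transform landing on the face lands at an end of the edge
(`InReachable`).

The other levels cannot help: the shift makes all three supported entries positive, and the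
d-measure of the zero set never increases. Exchanging mass with an empty level strictly lowers it,
unless the step merely permutes levels of equal d. The target has the initial zero measure, so no
such loss is possible. -/

namespace ThermalOps

/-- A convex region of triples of (shifted) ratios `p i / d i` on three levels with `d`-ratios
`β = d₂ / d₁` and `γ = d₃ / d₂`. It is stable under all swaps of the three levels. -/
structure InRegion (β γ t u v w : ℝ) : Prop where
  v_nonneg : 0 ≤ v
  v_le : v ≤ 1
  w_nonneg : 0 ≤ w
  w_le : w ≤ 1
  u_le : u ≤ 1
  mass : u + β * v + β * γ * w = 1 + t * (β * γ)
  le_u : (1 - β) * (1 - β * γ + β * γ * t) ≤ u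
  face_le : β * v + (1 - t) * (β * γ) * w ≤ β + (1 - t) * (β * γ) * (1 - β + β * γ * t)

/-- The part of the region that avoids the relative interior of the edge cut out by `face_le`. -/
def InReachable (β γ t u v w : ℝ) : Prop :=
  InRegion β γ t u v w ∧
    (β * v + (1 - t) * (β * γ) * w = β + (1 - t) * (β * γ) * (1 - β + β * γ * t) →
      v = 1 ∨ u = (1 - β) * (1 - β * γ + β * γ * t))

/-! ### Three levels: the invariant polytope and its unreachable open edge -/

section Region

variable {β γ t u v w : ℝ}

theorem InRegion.combo {u' v' w' l : ℝ} (h : InRegion β γ t u v w) (h' : InRegion β γ t u' v' w')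
    (l0 : 0 ≤ l) (l1 : l ≤ 1) :
    InRegion β γ t ((1 - l) * u + l * u') ((1 - l) * v + l * v') ((1 - l) * w + l * w') := by
  have k0 : 0 ≤ 1 - l := by linarith
  have hle : ∀ {x y z : ℝ}, x ≤ z → y ≤ z → (1 - l) * x + l * y ≤ z := fun hx hy => by
    nlinarith [mul_le_mul_of_nonneg_left hx k0, mul_le_mul_of_nonneg_left hy l0]
  have hge : ∀ {x y z : ℝ}, z ≤ x → z ≤ y → z ≤ (1 - l) * x + l * y := fun hx hy => by
    nlinarith [mul_le_mul_of_nonneg_left hx k0, mul_le_mul_of_nonneg_left hy l0]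
  refine ⟨hge h.v_nonneg h'.v_nonneg, hle h.v_le h'.v_le, hge h.w_nonneg h'.w_nonneg,
    hle h.w_le h'.w_le, hle h.u_le h'.u_le, ?_, hge h.le_u h'.le_u, ?_⟩
  · linear_combination (1 - l) * h.mass + l * h'.mass
  · have := hle h.face_le h'.face_le
    linarith

theorem InRegion.u_nonneg (h : InRegion β γ t u v w) (hβ : 0 < β) (hβ1 : β < 1) (hγ : 0 < γ)
    (hγ1 : γ < 1) (ht : 0 < t) : 0 ≤ u := by
  refine le_trans ?_ h.le_u
  have h1 : β * γ < 1 := by nlinarith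
  have h2 : 0 < β * γ * t := by positivity
  exact mul_nonneg (by linarith) (by linarith)

/-- The strict inequality is what keeps every nontrivial 12-transform off the face; it is where the
smallness of t enters. -/
theorem InRegion.swap₁₂ (h : InRegion β γ t u v w) (hβ : 0 < β) (hβ1 : β < 1) (hγ : 0 < γ)
    (hγ1 : γ < 1) (ht : 0 < t) (ht1 : t < 1) (htβ : t * (1 - β * γ) < 1 - β) :
    InRegion β γ t ((1 - β) * u + β * v) u w ∧
      β * u + (1 - t) * (β * γ) * w < β + (1 - t) * (β * γ) * (1 - β + β * γ * t) := by
  have hu := h.u_nonneg hβ hβ1 hγ hγ1 ht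
  obtain ⟨v0, v1, w0, w1, u1, hm, hr, hf⟩ := h
  have hα : 0 < β * γ := by positivity
  have hα1 : β * γ < β := by nlinarith
  generalize hαe : β * γ = α at *
  have hmass : u + α * w ≤ 1 + t * α := by nlinarith
  have hface : β * u + (1 - t) * α * w < β + (1 - t) * α * (1 - β + α * t) := by
    -- A linear program with one mass constraint: a unit of mass scores β in u and 1 - t in w, and
    -- the larger score decides which variable saturates. The gaps left are α²t(1 - t) and (1 -
    -- t)α(1 - β - t(1 - α)).
    rcases le_or_gt β (1 - t) with hc | hc
    · -- the optimum has `w = 1`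
      have e : β * u + (1 - t) * α * w ≤ β * (1 + t * α) + (1 - t - β) * α := by
        nlinarith [mul_le_mul_of_nonneg_left hmass hβ.le,
          mul_le_mul_of_nonneg_left w1 (mul_nonneg (sub_nonneg.2 hc) hα.le)]
      nlinarith [mul_pos (mul_pos (mul_pos hα hα) ht) (sub_pos.2 ht1)]
    · -- the optimum has `u = 1`
      have e : β * u + (1 - t) * α * w ≤ (1 - t) * (1 + t * α) + (β - (1 - t)) := by
        nlinarith [mul_le_mul_of_nonneg_left hmass (sub_pos.2 ht1).le,
          mul_le_mul_of_nonneg_left u1 (sub_pos.2 hc).le]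
      nlinarith [mul_pos (mul_pos (sub_pos.2 ht1) hα) (sub_pos.2 htβ)]
  refine ⟨⟨hu, u1, w0, w1, ?_, ?_, ?_, ?_⟩, hface⟩
  · nlinarith
  · rw [hαe]; linarith
  · rw [hαe]
    nlinarith [mul_nonneg (mul_nonneg hβ.le hβ.le) v0, mul_nonneg hα.le (sub_nonneg.2 w1)]
  · rw [hαe]; exact hface.le

theorem InRegion.swap₁₃ (h : InRegion β γ t u v w) (hβ : 0 < β) (hβ1 : β < 1) (hγ : 0 < γ)
    (hγ1 : γ < 1) (ht : 0 < t) (ht1 : t < 1) :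
    InRegion β γ t ((1 - β * γ) * u + β * γ * w) v u ∧
      (β * v + (1 - t) * (β * γ) * u = β + (1 - t) * (β * γ) * (1 - β + β * γ * t) → v = 1) := by
  have hu := h.u_nonneg hβ hβ1 hγ hγ1 ht
  obtain ⟨v0, v1, w0, w1, u1, hm, hr, hf⟩ := h
  have hα : 0 < β * γ := by positivity
  have hα1 : β * γ < β := by nlinarith
  generalize hαe : β * γ = α at *
  have hmass : u + β * v ≤ 1 + t * α := by nlinarith
  have hta : (1 - t) * α < 1 := by nlinarith
  -- Bounding u by the mass constraint leaves a gap to the face of at least a positive multiple of 1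
  -- - v.
  have e : β * v + (1 - t) * α * u ≤
      β + (1 - t) * α * (1 - β + α * t) - (1 - (1 - t) * α) * (β * (1 - v)) := by
    nlinarith [mul_le_mul_of_nonneg_left hmass (mul_pos (sub_pos.2 ht1) hα).le]
  refine ⟨⟨v0, v1, hu, u1, ?_, ?_, ?_, ?_⟩, fun hq => ?_⟩
  · nlinarith
  · rw [hαe]; linarith
  · rw [hαe]
    nlinarith [mul_nonneg (mul_nonneg hα.le hα.le) w0, mul_nonneg hβ.le (sub_nonneg.2 v1),
      mul_pos (mul_pos hα ht) (sub_pos.2 hα1)]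
  · rw [hαe]
    have := mul_nonneg (sub_pos.2 hta).le (mul_nonneg hβ.le (sub_nonneg.2 v1))
    linarith
  · by_contra hne
    have hlt : v < 1 := lt_of_le_of_ne v1 hne
    have := mul_pos (sub_pos.2 hta) (mul_pos hβ (sub_pos.2 hlt))
    linarith

theorem InRegion.swap₂₃ (h : InRegion β γ t u v w) (hβ : 0 < β) (hγ : 0 < γ)
    (hγ1 : γ < 1) (ht : 0 < t) (ht1 : t < 1) :
    InRegion β γ t u ((1 - γ) * v + γ * w) v ∧
      (β * ((1 - γ) * v + γ * w) + (1 - t) * (β * γ) * v =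
        β + (1 - t) * (β * γ) * (1 - β + β * γ * t) →
          u = (1 - β) * (1 - β * γ + β * γ * t)) := by
  obtain ⟨v0, v1, w0, w1, u1, hm, hr, hf⟩ := h
  have hα : 0 < β * γ := by positivity
  have htγ : t * γ < 1 := by nlinarith
  -- Modulo mass conservation, the gap to the face is a nonnegative combination of the slacks of
  -- `le_u` and `w_le`, with positive weight on the former.
  have e : β * ((1 - γ) * v + γ * w) + (1 - t) * (β * γ) * v =
      β + (1 - t) * (β * γ) * (1 - β + β * γ * t)
        - (1 - t * γ) * (u - (1 - β) * (1 - β * γ + β * γ * t)) - t * γ * (β * γ) * (1 - w) := by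
    linear_combination (1 - t * γ) * hm
  have e2 := mul_nonneg (mul_pos (mul_pos ht hγ) hα).le (sub_nonneg.2 w1)
  refine ⟨⟨?_, ?_, v0, v1, u1, ?_, hr, ?_⟩, fun hq => ?_⟩
  · nlinarith
  · nlinarith
  · linarith
  · have := mul_nonneg (sub_pos.2 htγ).le (sub_nonneg.2 hr)
    linarith
  · by_contra hne
    have hlt := lt_of_le_of_ne hr (Ne.symm hne)
    have := mul_pos (sub_pos.2 htγ) (sub_pos.2 hlt)
    linarith

theorem InReachable.transform₁₂ {l : ℝ} (h : InReachable β γ t u v w) (hβ : 0 < β) (hβ1 : β < 1)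
    (hγ : 0 < γ) (hγ1 : γ < 1) (ht : 0 < t) (ht1 : t < 1) (htβ : t * (1 - β * γ) < 1 - β)
    (l0 : 0 ≤ l) (l1 : l ≤ 1) :
    InReachable β γ t ((1 - l) * u + l * ((1 - β) * u + β * v)) ((1 - l) * v + l * u) w := by
  obtain ⟨hs, hf⟩ := h.1.swap₁₂ hβ hβ1 hγ hγ1 ht ht1 htβ
  rcases l0.eq_or_lt with rfl | l0'
  · simpa using h
  have hc := h.1.combo hs l0 l1
  rw [show (1 - l) * w + l * w = w by ring] at hc
  refine ⟨hc, fun hq => ?_⟩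
  nlinarith [mul_le_mul_of_nonneg_left h.1.face_le (sub_nonneg.2 l1), mul_lt_mul_of_pos_left hf l0']

/-- Extremality: if a mixture attains the maximum, so does its swapped part, which has weight l > 0.
-/
theorem eq_of_combo_eq {x y m l : ℝ} (hx : x ≤ m) (hy : y ≤ m) (l0 : 0 < l) (l1 : l ≤ 1)
    (h : (1 - l) * x + l * y = m) : y = m := by
  by_contra hne
  nlinarith [mul_le_mul_of_nonneg_left hx (sub_nonneg.2 l1),
    mul_lt_mul_of_pos_left (lt_of_le_of_ne hy hne) l0]

theorem InReachable.transform₁₃ {l : ℝ} (h : InReachable β γ t u v w) (hβ : 0 < β) (hβ1 : β < 1)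
    (hγ : 0 < γ) (hγ1 : γ < 1) (ht : 0 < t) (ht1 : t < 1) (l0 : 0 ≤ l) (l1 : l ≤ 1) :
    InReachable β γ t ((1 - l) * u + l * ((1 - β * γ) * u + β * γ * w)) v
      ((1 - l) * w + l * u) := by
  obtain ⟨hs, hf⟩ := h.1.swap₁₃ hβ hβ1 hγ hγ1 ht ht1
  rcases l0.eq_or_lt with rfl | l0'
  · simpa using h
  have hc := h.1.combo hs l0 l1
  rw [show (1 - l) * v + l * v = v by ring] at hc
  refine ⟨hc, fun hq => Or.inl (hf (eq_of_combo_eq h.1.face_le hs.face_le l0' l1 ?_))⟩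
  rw [← hq]; ring

theorem InReachable.transform₂₃ {l : ℝ} (h : InReachable β γ t u v w) (hβ : 0 < β)
    (hγ : 0 < γ) (hγ1 : γ < 1) (ht : 0 < t) (ht1 : t < 1) (l0 : 0 ≤ l) (l1 : l ≤ 1) :
    InReachable β γ t u ((1 - l) * v + l * ((1 - γ) * v + γ * w)) ((1 - l) * w + l * v) := by
  obtain ⟨hs, hf⟩ := h.1.swap₂₃ hβ hγ hγ1 ht ht1
  rcases l0.eq_or_lt with rfl | l0'
  · simpa using h
  have hc := h.1.combo hs l0 l1
  rw [show (1 - l) * u + l * u = u by ring] at hc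
  refine ⟨hc, fun hq => Or.inr (hf (eq_of_combo_eq h.1.face_le hs.face_le l0' l1 ?_))⟩
  rw [← hq]; ring

theorem inReachable_initial (hβ : 0 < β) (hγ : 0 < γ) (hγ1 : γ < 1) (ht : 0 < t)
    (ht1 : t < 1) (htβ : t * (1 - β * γ) < 1 - β) : InReachable β γ t 1 0 t := by
  have hα : 0 < β * γ := by positivity
  have hα1 : β * γ < β := by nlinarith
  have hf : β * 0 + (1 - t) * (β * γ) * t < β + (1 - t) * (β * γ) * (1 - β + β * γ * t) := by
    nlinarith [mul_pos (mul_pos (sub_pos.2 ht1) hα) (sub_pos.2 htβ)]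
  refine ⟨⟨le_rfl, zero_le_one, ht.le, ht1.le, le_rfl, by ring, ?_, hf.le⟩, fun h => ?_⟩
  · have : β * γ * t < β * γ := by nlinarith
    nlinarith
  · exact absurd h hf.ne

end Region

/-! ### Action of a single transform on vectors -/

section Step

variable {Ω : Type*} [DecidableEq Ω]

/-- The action of a `T^d`-transform on a vector. -/
noncomputable def transformVec (d : Ω → ℝ) (i j : Ω) (l : ℝ) (p : Ω → ℝ) : Ω → ℝ := fun k =>
  if k = i then (1 - l * (d j / d i)) * p i + l * p j
  else if k = j then l * (d j / d i) * p i + (1 - l) * p j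
  else p k

theorem transformVec_left (d : Ω → ℝ) (i j : Ω) (l : ℝ) (p : Ω → ℝ) :
    transformVec d i j l p i = (1 - l * (d j / d i)) * p i + l * p j := by
  simp [transformVec]

theorem transformVec_right (d : Ω → ℝ) {i j : Ω} (hij : i ≠ j) (l : ℝ) (p : Ω → ℝ) :
    transformVec d i j l p j = l * (d j / d i) * p i + (1 - l) * p j := by
  simp [transformVec, hij.symm]

theorem transformVec_of_ne (d : Ω → ℝ) {i j k : Ω} (hi : k ≠ i) (hj : k ≠ j) (l : ℝ)
    (p : Ω → ℝ) : transformVec d i j l p k = p k := by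
  simp [transformVec, hi, hj]

variable [Fintype Ω]

theorem swapMatrix_mulVec (d : Ω → ℝ) {i j : Ω} (hij : i ≠ j) (p : Ω → ℝ) :
    (swapMatrix d i j).mulVec p = transformVec d i j 1 p := by
  have key : ∀ g : Ω → ℝ, (∀ k, k ≠ i → k ≠ j → g k = 0) → ∑ k, g k = g i + g j := by
    intro g hg
    rw [← Finset.sum_pair hij]
    refine (Finset.sum_subset (Finset.subset_univ _) fun k _ hk => ?_).symm
    simp only [Finset.mem_insert, Finset.mem_singleton, not_or] at hk
    exact hg k hk.1 hk.2
  funext k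
  by_cases hk : k = i ∨ k = j
  · simp only [Matrix.mulVec, dotProduct]
    rw [key]
    · rcases hk with rfl | rfl
      · simp [swapMatrix, transformVec, hij, hij.symm]
      · simp [swapMatrix, transformVec, hij, hij.symm]
    · intro m hmi hmj
      rcases hk with rfl | rfl <;> simp [swapMatrix, hij, hmi, hmj, hmi.symm, hmj.symm]
  · push Not at hk
    simp only [Matrix.mulVec, dotProduct]
    rw [Finset.sum_eq_single k]
    · simp [swapMatrix, transformVec, hij, hk.1, hk.2]
    · intro m _ hm
      simp [swapMatrix, hij, hk.1, hk.2, hm.symm]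
    · simp

theorem transform_mulVec (d : Ω → ℝ) {i j : Ω} (hij : i ≠ j) (l : ℝ) (p : Ω → ℝ) :
    ((1 - l) • (1 : Matrix Ω Ω ℝ) + l • swapMatrix d i j).mulVec p = transformVec d i j l p := by
  rw [Matrix.add_mulVec, Matrix.smul_mulVec, Matrix.smul_mulVec, Matrix.one_mulVec,
    swapMatrix_mulVec d hij]
  funext k
  simp only [Pi.add_apply, Pi.smul_apply, smul_eq_mul, transformVec]
  split_ifs with h1 h2
  · subst h1; ring
  · subst h2; ring
  · ring

/-- The `d`-measure of the set where `p` vanishes. -/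
noncomputable def zeroMeasure (d p : Ω → ℝ) : ℝ := ∑ i, if p i = 0 then d i else 0

end Step

/-! ### Monotonicity of the d-measure of the zero set -/

section ZeroMeasure

variable {Ω : Type*} [DecidableEq Ω] {d p : Ω → ℝ} {i j : Ω} {l : ℝ}

theorem transformVec_zero (d : Ω → ℝ) (i j : Ω) (p : Ω → ℝ) : transformVec d i j 0 p = p := by
  funext k
  simp only [transformVec]
  split_ifs with h1 h2
  · subst h1; ring
  · subst h2; ring
  · rfl

theorem transformVec_one_of_eq (hi : d i ≠ 0) (h : d j = d i) (p : Ω → ℝ) :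
    transformVec d i j 1 p = p ∘ Equiv.swap i j := by
  funext k
  simp only [transformVec, h, div_self hi, Function.comp, Equiv.swap_apply_def]
  split_ifs <;> ring

theorem transformVec_nonneg (hd : ∀ i, 0 < d i) (hdij : d j ≤ d i) (l0 : 0 ≤ l) (l1 : l ≤ 1)
    (hp : ∀ k, 0 ≤ p k) (k : Ω) : 0 ≤ transformVec d i j l p k := by
  have hγ1 : d j / d i ≤ 1 := (div_le_one (hd i)).2 hdij
  have hγ0 : 0 ≤ d j / d i := (div_pos (hd j) (hd i)).le
  have hlγ : l * (d j / d i) ≤ 1 := mul_le_one₀ l1 hγ0 hγ1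
  simp only [transformVec]
  split_ifs
  · exact add_nonneg (mul_nonneg (sub_nonneg.2 hlγ) (hp i)) (mul_nonneg l0 (hp j))
  · exact add_nonneg (mul_nonneg (mul_nonneg l0 hγ0) (hp i))
      (mul_nonneg (sub_nonneg.2 l1) (hp j))
  · exact hp k

variable [Fintype Ω]

theorem sum_transformVec (d : Ω → ℝ) {i j : Ω} (hij : i ≠ j) (l : ℝ) (p : Ω → ℝ) :
    ∑ k, transformVec d i j l p k = ∑ k, p k := by
  have hj : j ∈ Finset.univ.erase i := by simp [hij.symm]
  rw [← Finset.add_sum_erase _ _ (Finset.mem_univ i), ← Finset.add_sum_erase _ _ hj,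
    ← Finset.add_sum_erase _ p (Finset.mem_univ i), ← Finset.add_sum_erase _ p hj,
    transformVec_left, transformVec_right d hij]
  rw [Finset.sum_congr rfl fun k hk => transformVec_of_ne d
    (Finset.ne_of_mem_erase (Finset.mem_of_mem_erase hk)) (Finset.ne_of_mem_erase hk) l p]
  ring

theorem zeroMeasure_transformVec (hij : i ≠ j) :
    zeroMeasure d (transformVec d i j l p) + (if p i = 0 then d i else 0)
        + (if p j = 0 then d j else 0) =
      zeroMeasure d p + (if transformVec d i j l p i = 0 then d i else 0)
        + (if transformVec d i j l p j = 0 then d j else 0) := by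
  have hj : j ∈ Finset.univ.erase i := by simp [hij.symm]
  unfold zeroMeasure
  rw [← Finset.add_sum_erase _ _ (Finset.mem_univ i), ← Finset.add_sum_erase _ _ hj,
    ← Finset.add_sum_erase _ (fun k => if p k = 0 then d k else 0) (Finset.mem_univ i),
    ← Finset.add_sum_erase _ (fun k => if p k = 0 then d k else 0) hj]
  rw [Finset.sum_congr rfl fun k hk => by rw [transformVec_of_ne d
    (Finset.ne_of_mem_erase (Finset.mem_of_mem_erase hk)) (Finset.ne_of_mem_erase hk) l p]]
  ring

/-- A full swap moves the zero from i to j, so the number of zeros is unchanged; weighting by d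
still detects a loss when d j < d i. For 0 < l < 1 the zero disappears. -/
theorem transform_cases_of_zero_left (hd : ∀ i, 0 < d i) (hij : i ≠ j) (hdij : d j ≤ d i)
    (l0 : 0 ≤ l) (l1 : l ≤ 1) (hi : p i = 0) (hj : 0 < p j) :
    l = 0 ∨ (l = 1 ∧ d j = d i) ∨ zeroMeasure d (transformVec d i j l p) < zeroMeasure d p := by
  have hz := zeroMeasure_transformVec (d := d) (p := p) (l := l) hij
  rw [transformVec_left, transformVec_right d hij, hi] at hz
  simp only [mul_zero, zero_add, hj.ne', if_true, if_false] at hz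
  rcases l0.eq_or_lt with rfl | l0'
  · exact Or.inl rfl
  refine Or.inr ?_
  rw [if_neg (mul_pos l0' hj).ne'] at hz
  rcases l1.eq_or_lt with rfl | l1'
  · rcases hdij.eq_or_lt with he | hlt
    · exact Or.inl ⟨rfl, he⟩
    · simp only [sub_self, zero_mul, if_true] at hz
      exact Or.inr (by linarith)
  · rw [if_neg (mul_pos (sub_pos.2 l1') hj).ne'] at hz
    exact Or.inr (by linarith [hd i])

theorem transform_cases_of_zero_right (hd : ∀ i, 0 < d i) (hij : i ≠ j) (hdij : d j ≤ d i)
    (l0 : 0 ≤ l) (l1 : l ≤ 1) (hi : 0 < p i) (hj : p j = 0) :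
    l = 0 ∨ (l = 1 ∧ d j = d i) ∨ zeroMeasure d (transformVec d i j l p) < zeroMeasure d p := by
  have hz := zeroMeasure_transformVec (d := d) (p := p) (l := l) hij
  have hγ0 : 0 < d j / d i := div_pos (hd j) (hd i)
  rw [transformVec_left, transformVec_right d hij, hj] at hz
  simp only [mul_zero, add_zero, hi.ne', if_true, if_false] at hz
  rcases l0.eq_or_lt with rfl | l0'
  · exact Or.inl rfl
  refine Or.inr ?_
  rw [if_neg (mul_pos (mul_pos l0' hγ0) hi).ne'] at hz
  rcases hdij.eq_or_lt with he | hlt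
  · rcases l1.eq_or_lt with rfl | l1'
    · exact Or.inl ⟨rfl, he⟩
    · rw [he, div_self (hd i).ne', mul_one, if_neg (mul_pos (sub_pos.2 l1') hi).ne'] at hz
      exact Or.inr (by linarith [hd i])
  · have hγ1 : d j / d i < 1 := (div_lt_one (hd i)).2 hlt
    have : l * (d j / d i) < 1 := by nlinarith
    rw [if_neg (mul_pos (sub_pos.2 this) hi).ne'] at hz
    exact Or.inr (by linarith [hd j])

theorem transform_cases_of_zero (hd : ∀ i, 0 < d i) (hij : i ≠ j) (hdij : d j ≤ d i)
    (l0 : 0 ≤ l) (l1 : l ≤ 1) (h : (p i = 0 ∧ 0 < p j) ∨ (0 < p i ∧ p j = 0)) :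
    transformVec d i j l p = p ∨
      (d j = d i ∧ transformVec d i j l p = p ∘ Equiv.swap i j) ∨
      zeroMeasure d (transformVec d i j l p) < zeroMeasure d p := by
  have : l = 0 ∨ (l = 1 ∧ d j = d i) ∨
      zeroMeasure d (transformVec d i j l p) < zeroMeasure d p := by
    rcases h with ⟨hi, hj⟩ | ⟨hi, hj⟩
    · exact transform_cases_of_zero_left hd hij hdij l0 l1 hi hj
    · exact transform_cases_of_zero_right hd hij hdij l0 l1 hi hj
  rcases this with rfl | ⟨rfl, he⟩ | hlt
  · exact Or.inl (transformVec_zero d i j p)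
  · exact Or.inr (Or.inl ⟨he, transformVec_one_of_eq (hd i).ne' he p⟩)
  · exact Or.inr (Or.inr hlt)

theorem zeroMeasure_comp_swap (h : d j = d i) (p : Ω → ℝ) :
    zeroMeasure d (p ∘ Equiv.swap i j) = zeroMeasure d p := by
  unfold zeroMeasure
  rw [← Equiv.sum_comp (Equiv.swap i j) fun k => if p k = 0 then d k else 0]
  refine Finset.sum_congr rfl fun k _ => ?_
  have : d (Equiv.swap i j k) = d k := by
    rw [Equiv.swap_apply_def]
    split_ifs with h1 h2
    · rw [h1, h]
    · rw [h2, h]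
    · rfl
  simp only [Function.comp, this]

theorem zeroMeasure_transformVec_le (hd : ∀ i, 0 < d i) (hij : i ≠ j) (hdij : d j ≤ d i)
    (l0 : 0 ≤ l) (l1 : l ≤ 1) (hp : ∀ k, 0 ≤ p k) :
    zeroMeasure d (transformVec d i j l p) ≤ zeroMeasure d p := by
  have mixed : ((p i = 0 ∧ 0 < p j) ∨ (0 < p i ∧ p j = 0)) →
      zeroMeasure d (transformVec d i j l p) ≤ zeroMeasure d p := fun h => by
    rcases transform_cases_of_zero hd hij hdij l0 l1 h with he | ⟨he, he'⟩ | hlt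
    · rw [he]
    · rw [he', zeroMeasure_comp_swap he]
    · exact hlt.le
  rcases (hp i).eq_or_lt with hi | hi <;> rcases (hp j).eq_or_lt with hj | hj
  · have hz := zeroMeasure_transformVec (d := d) (p := p) (l := l) hij
    rw [transformVec_left, transformVec_right d hij, ← hi, ← hj] at hz
    simp only [mul_zero, add_zero, if_true] at hz
    linarith
  · exact mixed (Or.inl ⟨hi.symm, hj⟩)
  · exact mixed (Or.inr ⟨hi, hj.symm⟩)
  · have hγ0 : 0 < d j / d i := div_pos (hd j) (hd i)
    have hγ1 : d j / d i ≤ 1 := (div_le_one (hd i)).2 hdij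
    have hz := zeroMeasure_transformVec (d := d) (p := p) (l := l) hij
    have h1 : 0 < transformVec d i j l p i := by
      rw [transformVec_left]
      rcases l0.eq_or_lt with rfl | l0'
      · simpa using hi
      · exact add_pos_of_nonneg_of_pos
          (mul_nonneg (sub_nonneg.2 (mul_le_one₀ l1 hγ0.le hγ1)) hi.le) (mul_pos l0' hj)
    have h2 : 0 < transformVec d i j l p j := by
      rw [transformVec_right d hij]
      rcases l0.eq_or_lt with rfl | l0'
      · simpa using hj
      · exact add_pos_of_pos_of_nonneg (mul_pos (mul_pos l0' hγ0) hi)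
          (mul_nonneg (sub_nonneg.2 l1) hj.le)
    rw [if_neg hi.ne', if_neg hj.ne', if_neg h1.ne', if_neg h2.ne'] at hz
    linarith

end ZeroMeasure

/-! ### Reduction of many levels to three -/

section Reachable

variable {Ω : Type*} {d p : Ω → ℝ} {i j : Ω} {a b c s t l : ℝ}

/-- `p` is supported on `x, y, z`, and its ratios `p k / d k` there are `s * (1 + u)`, `s * (1 + v)`
and `s * (1 + w)`. -/
structure HasRatios (d : Ω → ℝ) (s : ℝ) (x y z : Ω) (u v w : ℝ) (p : Ω → ℝ) : Prop where
  fst : p x = s * (d x * (1 + u))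
  snd : p y = s * (d y * (1 + v))
  trd : p z = s * (d z * (1 + w))
  zero : ∀ k, k ≠ x → k ≠ y → k ≠ z → p k = 0

section HasRatios

variable {x y z : Ω} {u v w : ℝ}

theorem HasRatios.midpoint {u' v' w' : ℝ} {p' : Ω → ℝ} (h : HasRatios d s x y z u v w p)
    (h' : HasRatios d s x y z u' v' w' p') :
    HasRatios d s x y z ((u + u') / 2) ((v + v') / 2) ((w + w') / 2)
      ((1 / 2 : ℝ) • p + (1 / 2 : ℝ) • p') := by
  refine ⟨?_, ?_, ?_, fun k kx ky kz => ?_⟩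
  · simp only [Pi.add_apply, Pi.smul_apply, smul_eq_mul, h.fst, h'.fst]; ring
  · simp only [Pi.add_apply, Pi.smul_apply, smul_eq_mul, h.snd, h'.snd]; ring
  · simp only [Pi.add_apply, Pi.smul_apply, smul_eq_mul, h.trd, h'.trd]; ring
  · simp only [Pi.add_apply, Pi.smul_apply, smul_eq_mul, h.zero k kx ky kz,
      h'.zero k kx ky kz]; ring

variable [DecidableEq Ω]

theorem HasRatios.transform₁₂ (h : HasRatios d s x y z u v w p) (hx : d x ≠ 0) (hyx : y ≠ x)
    (hzx : z ≠ x) (hzy : z ≠ y) (l : ℝ) :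
    HasRatios d s x y z ((1 - l) * u + l * ((1 - d y / d x) * u + d y / d x * v))
      ((1 - l) * v + l * u) w (transformVec d x y l p) := by
  obtain ⟨px, py, pz, h0⟩ := h
  refine ⟨?_, ?_, ?_, fun k kx ky kz => ?_⟩
  · rw [transformVec_left, px, py]; field_simp; ring
  · rw [transformVec_right d hyx.symm, px, py]; field_simp; ring
  · rw [transformVec_of_ne d hzx hzy, pz]
  · rw [transformVec_of_ne d kx ky, h0 k kx ky kz]

theorem HasRatios.transform₁₃ (h : HasRatios d s x y z u v w p) (hx : d x ≠ 0) (hyx : y ≠ x)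
    (hzx : z ≠ x) (hzy : z ≠ y) (l : ℝ) :
    HasRatios d s x y z ((1 - l) * u + l * ((1 - d z / d x) * u + d z / d x * w)) v
      ((1 - l) * w + l * u) (transformVec d x z l p) := by
  obtain ⟨px, py, pz, h0⟩ := h
  refine ⟨?_, ?_, ?_, fun k kx ky kz => ?_⟩
  · rw [transformVec_left, px, pz]; field_simp; ring
  · rw [transformVec_of_ne d hyx hzy.symm, py]
  · rw [transformVec_right d hzx.symm, px, pz]; field_simp; ring
  · rw [transformVec_of_ne d kx kz, h0 k kx ky kz]

theorem HasRatios.transform₂₃ (h : HasRatios d s x y z u v w p) (hy : d y ≠ 0) (hyx : y ≠ x)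
    (hzx : z ≠ x) (hzy : z ≠ y) (l : ℝ) :
    HasRatios d s x y z u ((1 - l) * v + l * ((1 - d z / d y) * v + d z / d y * w))
      ((1 - l) * w + l * v) (transformVec d y z l p) := by
  obtain ⟨px, py, pz, h0⟩ := h
  refine ⟨?_, ?_, ?_, fun k kx ky kz => ?_⟩
  · rw [transformVec_of_ne d hyx.symm hzx.symm, px]
  · rw [transformVec_left, py, pz]; field_simp; ring
  · rw [transformVec_right d hzy.symm, py, pz]; field_simp; ring
  · rw [transformVec_of_ne d ky kz, h0 k kx ky kz]

end HasRatios

/-- `p` is supported on three indices with `d`-values `a, b, c`, and its shifted ratios there form a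
reachable triple. -/
def IsReachableVec (d : Ω → ℝ) (a b c s t : ℝ) (p : Ω → ℝ) : Prop :=
  ∃ x y z : Ω, ∃ u v w : ℝ, d x = a ∧ d y = b ∧ d z = c ∧ InReachable (b / a) (c / b) t u v w ∧
    HasRatios d s x y z u v w p

variable [DecidableEq Ω]

/-- Swaps of equal levels can move the support, which is why reachability fixes only the values a,
b, c and not the indices. -/
theorem IsReachableVec.comp_swap (h : IsReachableVec d a b c s t p) (hij : d j = d i) :
    IsReachableVec d a b c s t (p ∘ Equiv.swap i j) := by
  have hdσ : ∀ k, d (Equiv.swap i j k) = d k := fun k => by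
    rw [Equiv.swap_apply_def]
    split_ifs with h1 h2
    · rw [h1, hij]
    · rw [h2, hij]
    · rfl
  obtain ⟨x, y, z, u, v, w, hx, hy, hz, hr, px, py, pz, h0⟩ := h
  refine ⟨Equiv.swap i j x, Equiv.swap i j y, Equiv.swap i j z, u, v, w, ?_, ?_, ?_, hr, ?_, ?_, ?_,
    fun k kx ky kz => h0 _ ?_ ?_ ?_⟩
  · rw [hdσ, hx]
  · rw [hdσ, hy]
  · rw [hdσ, hz]
  · simpa [hdσ] using px
  · simpa [hdσ] using py
  · simpa [hdσ] using pz
  · rintro rfl; simp at kx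
  · rintro rfl; simp at ky
  · rintro rfl; simp at kz

variable [Fintype Ω]

theorem HasRatios.zeroMeasure_eq {x y z : Ω} {u v w : ℝ} (h : HasRatios d s x y z u v w p)
    (hz : 0 < d z) (hzy : d z < d y) (hyx : d y < d x) (hs : 0 < s) (hu : 0 ≤ u) (hv : 0 ≤ v)
    (hw : 0 ≤ w) : (∀ k, 0 ≤ p k) ∧ zeroMeasure d p = ∑ k, d k - (d x + d y + d z) := by
  obtain ⟨px, py, pz, h0⟩ := h
  have hy : 0 < d y := hz.trans hzy
  have hx : 0 < d x := hy.trans hyx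
  have px' : 0 < p x := by rw [px]; positivity
  have py' : 0 < p y := by rw [py]; positivity
  have pz' : 0 < p z := by rw [pz]; positivity
  have nyx : y ≠ x := by rintro rfl; linarith
  have nzx : z ≠ x := by rintro rfl; linarith
  have nzy : z ≠ y := by rintro rfl; linarith
  constructor
  · intro k
    by_cases kx : k = x
    · rw [kx]; exact px'.le
    by_cases ky : k = y
    · rw [ky]; exact py'.le
    by_cases kz : k = z
    · rw [kz]; exact pz'.le
    exact (h0 k kx ky kz).ge
  · have hy1 : y ∈ Finset.univ.erase x := by simp [nyx]
    have hz1 : z ∈ (Finset.univ.erase x).erase y := by simp [nzx, nzy]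
    unfold zeroMeasure
    rw [← Finset.add_sum_erase _ _ (Finset.mem_univ x), ← Finset.add_sum_erase _ _ hy1,
      ← Finset.add_sum_erase _ _ hz1,
      ← Finset.add_sum_erase _ d (Finset.mem_univ x), ← Finset.add_sum_erase _ d hy1,
      ← Finset.add_sum_erase _ d hz1, if_neg px'.ne', if_neg py'.ne', if_neg pz'.ne']
    rw [Finset.sum_congr rfl fun k hk => ?_]
    · ring
    · simp only [Finset.mem_erase, Finset.mem_univ, and_true] at hk
      rw [if_pos (h0 k hk.2.2 hk.2.1 hk.1)]

theorem IsReachableVec.zeroMeasure_eq (h : IsReachableVec d a b c s t p) (hc : 0 < c) (hcb : c < b)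
    (hba : b < a) (hs : 0 < s) (ht : 0 < t) :
    (∀ k, 0 ≤ p k) ∧ zeroMeasure d p = ∑ k, d k - (a + b + c) := by
  obtain ⟨x, y, z, u, v, w, rfl, rfl, rfl, ⟨hr, -⟩, hp⟩ := h
  have hb : 0 < d y := hc.trans hcb
  have ha : 0 < d x := hb.trans hba
  exact hp.zeroMeasure_eq hc hcb hba hs (hr.u_nonneg (div_pos hb ha) ((div_lt_one ha).2 hba)
    (div_pos hc hb) ((div_lt_one hb).2 hcb) ht) hr.v_nonneg hr.w_nonneg

theorem IsReachableVec.transformVec (h : IsReachableVec d a b c s t p) (hd : ∀ i, 0 < d i)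
    (hc : 0 < c) (hcb : c < b) (hba : b < a) (hs : 0 < s) (ht : 0 < t) (ht1 : t < 1)
    (htβ : t * (1 - b / a * (c / b)) < 1 - b / a) (hij : i ≠ j) (hdij : d j ≤ d i)
    (l0 : 0 ≤ l) (l1 : l ≤ 1) :
    IsReachableVec d a b c s t (transformVec d i j l p) ∨
      zeroMeasure d (ThermalOps.transformVec d i j l p) < zeroMeasure d p := by
  have h' := h
  obtain ⟨x, y, z, u, v, w, hx, hy, hz, hr, hp⟩ := h
  obtain ⟨px, py, pz, h0⟩ := id hp
  have hb : 0 < b := hc.trans hcb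
  have ha : 0 < a := hb.trans hba
  have hβ : 0 < b / a := div_pos hb ha
  have hβ1 : b / a < 1 := (div_lt_one ha).2 hba
  have hγ : 0 < c / b := div_pos hc hb
  have hγ1 : c / b < 1 := (div_lt_one hb).2 hcb
  have hu := hr.1.u_nonneg hβ hβ1 hγ hγ1 ht
  have hv := hr.1.v_nonneg
  have hw := hr.1.w_nonneg
  have hyx : y ≠ x := by rintro rfl; linarith
  have hzx : z ≠ x := by rintro rfl; linarith
  have hzy : z ≠ y := by rintro rfl; linarith
  have pos : ∀ k, ¬ (k ≠ x ∧ k ≠ y ∧ k ≠ z) → 0 < p k := fun k hk => by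
    have : k = x ∨ k = y ∨ k = z := by tauto
    rcases this with rfl | rfl | rfl
    · rw [px, hx]; positivity
    · rw [py, hy]; positivity
    · rw [pz, hz]; positivity
  have mixed : ((p i = 0 ∧ 0 < p j) ∨ (0 < p i ∧ p j = 0)) →
      IsReachableVec d a b c s t (ThermalOps.transformVec d i j l p) ∨
      zeroMeasure d (ThermalOps.transformVec d i j l p) < zeroMeasure d p := fun hm => by
    rcases transform_cases_of_zero hd hij hdij l0 l1 hm with he | ⟨he, he'⟩ | hlt
    · rw [he]; exact Or.inl h'
    · rw [he']; exact Or.inl (h'.comp_swap he)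
    · exact Or.inr hlt
  by_cases hi : i ≠ x ∧ i ≠ y ∧ i ≠ z <;> by_cases hj : j ≠ x ∧ j ≠ y ∧ j ≠ z
  · left
    have : ThermalOps.transformVec d i j l p = p := by
      have e1 := h0 i hi.1 hi.2.1 hi.2.2
      have e2 := h0 j hj.1 hj.2.1 hj.2.2
      funext k
      simp only [ThermalOps.transformVec]
      split_ifs with k1 k2
      · rw [k1, e1, e2]; ring
      · rw [k2, e1, e2]; ring
      · rfl
    rwa [this]
  · exact mixed (Or.inl ⟨h0 i hi.1 hi.2.1 hi.2.2, pos j hj⟩)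
  · exact mixed (Or.inr ⟨pos i hi, h0 j hj.1 hj.2.1 hj.2.2⟩)
  · left
    have hi' : i = x ∨ i = y ∨ i = z := by tauto
    have hj' : j = x ∨ j = y ∨ j = z := by tauto
    have order : (i = x ∧ j = y) ∨ (i = x ∧ j = z) ∨ (i = y ∧ j = z) := by
      rcases hi' with hi' | hi' | hi' <;> rcases hj' with hj' | hj' | hj' <;>
        first
          | exact Or.inl ⟨hi', hj'⟩
          | exact Or.inr (Or.inl ⟨hi', hj'⟩)
          | exact Or.inr (Or.inr ⟨hi', hj'⟩)
          | exact absurd (hi'.trans hj'.symm) hij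
          | (rw [hi', hj'] at hdij; linarith)
    rcases order with ⟨rfl, rfl⟩ | ⟨rfl, rfl⟩ | ⟨rfl, rfl⟩
    · refine ⟨i, j, z, _, _, _, hx, hy, hz,
        hr.transform₁₂ hβ hβ1 hγ hγ1 ht ht1 htβ l0 l1, ?_⟩
      have := hp.transform₁₂ (hd _).ne' hyx hzx hzy l
      rwa [hx, hy] at this
    · refine ⟨i, y, j, _, _, _, hx, hy, hz,
        hr.transform₁₃ hβ hβ1 hγ hγ1 ht ht1 l0 l1, ?_⟩
      have := hp.transform₁₃ (hd _).ne' hyx hzx hzy l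
      rwa [hx, hz, show c / a = b / a * (c / b) by field_simp] at this
    · refine ⟨x, i, j, _, _, _, hx, hy, hz,
        hr.transform₂₃ hβ hγ hγ1 ht ht1 l0 l1, ?_⟩
      have := hp.transform₂₃ (hd _).ne' hyx hzx hzy l
      rwa [hy, hz] at this

/-- Nothing but reachable vectors, and vectors with a smaller zero set, can be reached by products of
`T^d`-transforms from a reachable vector. -/
theorem IsReachableVec.mulVec_polytopeWETO {M : Matrix Ω Ω ℝ} (hM : M ∈ polytopeWETO d)
    (hd : ∀ i, 0 < d i) (hc : 0 < c) (hcb : c < b) (hba : b < a) (hs : 0 < s) (ht : 0 < t)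
    (ht1 : t < 1) (htβ : t * (1 - b / a * (c / b)) < 1 - b / a)
    (h : IsReachableVec d a b c s t p) :
    IsReachableVec d a b c s t (M.mulVec p) ∨
      zeroMeasure d (M.mulVec p) < ∑ k, d k - (a + b + c) := by
  -- For induction over factors the hypothesis must have the shape of the conclusion; nonnegativity
  -- is carried along so that a zero set that has shrunk stays small.
  suffices H : ∀ p : Ω → ℝ, (∀ k, 0 ≤ p k) →
      (IsReachableVec d a b c s t p ∨ zeroMeasure d p < ∑ k, d k - (a + b + c)) →
      (∀ k, 0 ≤ M.mulVec p k) ∧ (IsReachableVec d a b c s t (M.mulVec p) ∨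
        zeroMeasure d (M.mulVec p) < ∑ k, d k - (a + b + c)) from
    (H p (h.zeroMeasure_eq hc hcb hba hs ht).1 (Or.inl h)).2
  unfold polytopeWETO at hM
  refine Submonoid.closure_induction (motive := fun M _ => ∀ p : Ω → ℝ, (∀ k, 0 ≤ p k) →
      (IsReachableVec d a b c s t p ∨ zeroMeasure d p < ∑ k, d k - (a + b + c)) →
      (∀ k, 0 ≤ M.mulVec p k) ∧ (IsReachableVec d a b c s t (M.mulVec p) ∨
        zeroMeasure d (M.mulVec p) < ∑ k, d k - (a + b + c))) ?_ ?_ ?_ hM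
  · rintro _ ⟨P, hP, l, l0, l1, rfl⟩ p hp h
    obtain ⟨i, j, hdij, rfl⟩ := (isDSwap_iff hd P).1 hP
    by_cases hij : i = j
    · have : (1 - l) • (1 : Matrix Ω Ω ℝ) + l • swapMatrix d i j = 1 := by
        rw [swapMatrix, if_pos hij, ← add_smul]; simp
      rw [this, Matrix.one_mulVec]
      exact ⟨hp, h⟩
    · rw [transform_mulVec d hij]
      refine ⟨transformVec_nonneg hd hdij l0 l1 hp, ?_⟩
      rcases h with h | h
      · rw [← (h.zeroMeasure_eq hc hcb hba hs ht).2]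
        exact h.transformVec hd hc hcb hba hs ht ht1 htβ hij hdij l0 l1
      · exact Or.inr ((zeroMeasure_transformVec_le hd hij hdij l0 l1 hp).trans_lt h)
  · intro p hp h
    rw [Matrix.one_mulVec]
    exact ⟨hp, h⟩
  · intro A B _ _ hA hB p hp h
    obtain ⟨h1, h2⟩ := hB p hp h
    rw [← Matrix.mulVec_mulVec]
    exact hA _ h1 h2

end Reachable

/-! ### The midpoint of the edge separates the two theories -/

section Counterexample

variable {Ω : Type*} {d : Ω → ℝ} {i j : Ω}

/-- A vector on the extremal edge that is not reachable. -/
theorem not_isReachableVec_of_hasRatios {s t u v w : ℝ} {x y z : Ω} {q : Ω → ℝ} (hz : 0 < d z)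
    (hzy : d z < d y) (hyx : d y < d x) (hs : 0 < s) (hu : 0 ≤ u) (hv : 0 ≤ v) (hw : 0 ≤ w)
    (hface : d y / d x * v + (1 - t) * (d y / d x * (d z / d y)) * w =
      d y / d x + (1 - t) * (d y / d x * (d z / d y)) * (1 - d y / d x + d y / d x * (d z / d y) * t))
    (hv1 : v < 1) (hu1 : (1 - d y / d x) * (1 - d y / d x * (d z / d y)
      + d y / d x * (d z / d y) * t) < u)
    (hq : HasRatios d s x y z u v w q) : ¬ IsReachableVec d (d x) (d y) (d z) s t q := by
  rintro ⟨x', y', z', u', v', w', hx', hy', hz', ⟨-, hr⟩, hq'⟩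
  have hy0 : 0 < d y := hz.trans hzy
  have hx0 : 0 < d x := hy0.trans hyx
  have mem : ∀ k, 0 < q k → k = x' ∨ k = y' ∨ k = z' := fun k hk => by
    by_contra hne
    simp only [not_or] at hne
    exact hk.ne' (hq'.zero k hne.1 hne.2.1 hne.2.2)
  -- Every index of the support of q is among x', y', z'; distinct d-values then force the labels,
  -- hence the ratios, to agree.
  have ex : x = x' := by
    rcases mem x (by rw [hq.fst]; positivity) with h | h | h
    · exact h
    · rw [← h] at hy'; linarith
    · rw [← h] at hz'; linarith
  have ey : y = y' := by
    rcases mem y (by rw [hq.snd]; positivity) with h | h | h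
    · rw [← h] at hx'; linarith
    · exact h
    · rw [← h] at hz'; linarith
  have ez : z = z' := by
    rcases mem z (by rw [hq.trd]; positivity) with h | h | h
    · rw [← h] at hx'; linarith
    · rw [← h] at hy'; linarith
    · exact h
  subst ex ey ez
  have cancel : ∀ {e r r' : ℝ}, 0 < e → s * (e * (1 + r)) = s * (e * (1 + r')) → r = r' :=
    fun he h => add_left_cancel (mul_left_cancel₀ he.ne' (mul_left_cancel₀ hs.ne' h))
  have eu : u = u' := cancel hx0 (hq.fst.symm.trans hq'.fst)
  have ev : v = v' := cancel hy0 (hq.snd.symm.trans hq'.snd)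
  have ew : w = w' := cancel hz (hq.trd.symm.trans hq'.trd)
  subst eu ev ew
  rcases hr hface with h | h
  · exact hv1.ne h
  · exact hu1.ne' h

variable [DecidableEq Ω] [Fintype Ω]

theorem isDSwap_swapMatrix (hd : ∀ i, 0 < d i) (hij : d j ≤ d i) : IsDSwap d (swapMatrix d i j) :=
  (isDSwap_iff hd _).2 ⟨i, j, hij, rfl⟩

theorem mulVec_mem_stdSimplex_of_mem_closure (hd : ∀ i, 0 < d i) {M : Matrix Ω Ω ℝ}
    (hM : M ∈ Submonoid.closure {M : Matrix Ω Ω ℝ | IsDSwap d M}) {p : Ω → ℝ}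
    (hp : p ∈ stdSimplex ℝ Ω) : M.mulVec p ∈ stdSimplex ℝ Ω := by
  refine Submonoid.closure_induction (motive := fun M _ => ∀ p : Ω → ℝ, p ∈ stdSimplex ℝ Ω →
    M.mulVec p ∈ stdSimplex ℝ Ω) ?_ ?_ ?_ hM p hp
  · rintro P hP p hp
    obtain ⟨i, j, hdij, rfl⟩ := (isDSwap_iff hd P).1 hP
    by_cases hij : i = j
    · rwa [swapMatrix, if_pos hij, Matrix.one_mulVec]
    · rw [swapMatrix_mulVec d hij]
      exact ⟨transformVec_nonneg hd hdij zero_le_one le_rfl hp.1,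
        (sum_transformVec d hij 1 p).trans hp.2⟩
  · intro p hp
    rwa [Matrix.one_mulVec]
  · intro A B _ _ hA hB p hp
    rw [← Matrix.mulVec_mulVec]
    exact hA _ (hB p hp)

theorem exists_hasRatios_mem_stdSimplex (hd : ∀ i, 0 < d i) {x y z : Ω} (hyx : y ≠ x) (hzx : z ≠ x)
    (hzy : z ≠ y) {u v w : ℝ} (hu : 0 ≤ u) (hv : 0 ≤ v) (hw : 0 ≤ w) :
    ∃ s > 0, ∃ p ∈ stdSimplex ℝ Ω, HasRatios d s x y z u v w p := by
  have hx0 := hd x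
  have hy0 := hd y
  have hz0 := hd z
  have hN : 0 < d x * (1 + u) + d y * (1 + v) + d z * (1 + w) := by positivity
  obtain ⟨s, hs, hsN⟩ : ∃ s > 0, s * (d x * (1 + u) + d y * (1 + v) + d z * (1 + w)) = 1 :=
    ⟨_, inv_pos.2 hN, inv_mul_cancel₀ hN.ne'⟩
  refine ⟨s, hs, fun k => (if k = x then s * (d x * (1 + u)) else 0)
    + (if k = y then s * (d y * (1 + v)) else 0) + (if k = z then s * (d z * (1 + w)) else 0),
    ⟨fun k => by positivity, ?_⟩, ⟨?_, ?_, ?_, fun k kx ky kz => ?_⟩⟩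
  · simp only [Finset.sum_add_distrib, Finset.sum_ite_eq', Finset.mem_univ, if_true]
    linarith
  · simp [hyx.symm, hzx.symm]
  · simp [hyx, hzy.symm]
  · simp [hzx, hzy]
  · simp [kx, ky, kz]

/-- Three different values of `d` give a transformation that is an elementary, but not a weak
elementary thermal operation. -/
theorem exists_mem_ETO_notMem_WETO (hd : ∀ i, 0 < d i) {x y z : Ω} (hzy : d z < d y)
    (hyx : d y < d x) : ∃ pq ∈ resourceTheoryETO d, pq ∉ resourceTheoryWETO d := by
  have nyx : y ≠ x := by rintro rfl; exact lt_irrefl _ hyx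
  have nzy : z ≠ y := by rintro rfl; exact lt_irrefl _ hzy
  have nzx : z ≠ x := by rintro rfl; exact lt_asymm hyx hzy
  have hx0 := (hd x).ne'
  have hy0 := (hd y).ne'
  have hβ : 0 < d y / d x := div_pos (hd y) (hd x)
  have hβ1 : d y / d x < 1 := (div_lt_one (hd x)).2 hyx
  have hγ : 0 < d z / d y := div_pos (hd z) (hd y)
  have hγ1 : d z / d y < 1 := (div_lt_one (hd y)).2 hzy
  have hα : d z / d x = d y / d x * (d z / d y) := by field_simp
  obtain ⟨t, ht, ht1, htβ⟩ : ∃ t : ℝ, 0 < t ∧ t < 1 ∧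
      t * (1 - d y / d x * (d z / d y)) < 1 - d y / d x := by
    refine ⟨(1 - d y / d x) / 2, by linarith, by linarith, ?_⟩
    nlinarith [mul_pos hβ hγ]
  obtain ⟨s, hs, p, hp, hpr⟩ := exists_hasRatios_mem_stdSimplex hd nyx nzx nzy
    zero_le_one le_rfl ht.le
  -- The same three swaps in opposite orders; the rightmost factor acts first.
  let A := swapMatrix d y z * (swapMatrix d x y * swapMatrix d x z)
  let B := swapMatrix d x z * (swapMatrix d x y * swapMatrix d y z)
  have sub := fun {i j : Ω} (h : d j ≤ d i) =>
    (Submonoid.subset_closure (isDSwap_swapMatrix hd h) :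
      swapMatrix d i j ∈ Submonoid.closure {M : Matrix Ω Ω ℝ | IsDSwap d M})
  have hAm : A ∈ Submonoid.closure {M : Matrix Ω Ω ℝ | IsDSwap d M} :=
    mul_mem (sub hzy.le) (mul_mem (sub hyx.le) (sub (hzy.trans hyx).le))
  have hBm : B ∈ Submonoid.closure {M : Matrix Ω Ω ℝ | IsDSwap d M} :=
    mul_mem (sub (hzy.trans hyx).le) (mul_mem (sub hyx.le) (sub hzy.le))
  have hAr : HasRatios d s x y z ((1 - d y / d x) * (1 - d z / d x + d z / d x * t))
      ((1 - d z / d y) * (1 - d z / d x + d z / d x * t) + d z / d y)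
      (1 - d z / d x + d z / d x * t) (A.mulVec p) := by
    have := ((hpr.transform₁₃ hx0 nyx nzx nzy 1).transform₁₂ hx0 nyx nzx nzy 1).transform₂₃
      hy0 nyx nzx nzy 1
    rw [← swapMatrix_mulVec d nzx.symm, ← swapMatrix_mulVec d nyx.symm,
      ← swapMatrix_mulVec d nzy.symm, Matrix.mulVec_mulVec, Matrix.mulVec_mulVec, mul_assoc] at this
    convert this using 1 <;> ring
  have hBr : HasRatios d s x y z
      ((1 - d z / d x) * (1 - d y / d x + d y / d x * (d z / d y) * t)) 1
      (1 - d y / d x + d y / d x * (d z / d y) * t) (B.mulVec p) := by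
    have := ((hpr.transform₂₃ hy0 nyx nzx nzy 1).transform₁₂ hx0 nyx nzx nzy 1).transform₁₃
      hx0 nyx nzx nzy 1
    rw [← swapMatrix_mulVec d nzy.symm, ← swapMatrix_mulVec d nyx.symm,
      ← swapMatrix_mulVec d nzx.symm, Matrix.mulVec_mulVec, Matrix.mulVec_mulVec, mul_assoc] at this
    convert this using 1 <;> ring
  have hq := hAr.midpoint hBr
  have half : (0 : ℝ) ≤ 1 / 2 := by norm_num
  have half2 : (1 / 2 : ℝ) + 1 / 2 = 1 := by norm_num
  have hqs := (convex_stdSimplex ℝ Ω) (mulVec_mem_stdSimplex_of_mem_closure hd hAm hp)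
    (mulVec_mem_stdSimplex_of_mem_closure hd hBm hp) half half half2
  have hmulVec : (1 / 2 : ℝ) • A.mulVec p + (1 / 2 : ℝ) • B.mulVec p =
      ((1 / 2 : ℝ) • A + (1 / 2 : ℝ) • B).mulVec p := by
    rw [Matrix.add_mulVec, Matrix.smul_mulVec, Matrix.smul_mulVec]
  refine ⟨(p, (1 / 2 : ℝ) • A.mulVec p + (1 / 2 : ℝ) • B.mulVec p),
    ⟨hp, hqs, _, convex_convexHull ℝ _ (subset_convexHull ℝ _ hAm) (subset_convexHull ℝ _ hBm)
      half half half2, hmulVec⟩, ?_⟩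
  rintro ⟨-, -, M, hM, hqM⟩
  change (1 / 2 : ℝ) • A.mulVec p + (1 / 2 : ℝ) • B.mulVec p = M.mulVec p at hqM
  have hinit : IsReachableVec d (d x) (d y) (d z) s t p :=
    ⟨x, y, z, 1, 0, t, rfl, rfl, rfl, inReachable_initial hβ hγ hγ1 ht ht1 htβ, hpr⟩
  have key := hinit.mulVec_polytopeWETO hM hd (hd z) hzy hyx hs ht ht1 htβ
  rw [← hqM] at key
  rw [hα] at hq
  have hα0 := mul_pos hβ hγ
  have hα1 : d y / d x * (d z / d y) < d y / d x := by nlinarith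
  -- αt(β - α) is the difference of the u-coordinates of Bp and Ap, so the midpoint has u above the
  -- minimum; likewise `hv1` is the positivity of 1 - v at Ap.
  have hκ := mul_pos (mul_pos hα0 ht) (sub_pos.2 hα1)
  have hw : 0 < 1 - d y / d x * (d z / d y) + d y / d x * (d z / d y) * t := by
    nlinarith [mul_pos hα0 ht]
  have hw' : 0 < 1 - d y / d x + d y / d x * (d z / d y) * t := by nlinarith [mul_pos hα0 ht]
  have hv1 : 0 < (1 - d z / d y) * (d y / d x * (d z / d y) * (1 - t)) :=
    mul_pos (sub_pos.2 hγ1) (mul_pos hα0 (sub_pos.2 ht1))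
  have hv0 := mul_pos (sub_pos.2 hγ1) hw
  have hu0 := mul_pos (sub_pos.2 hβ1) hw
  have hu : 0 < ((1 - d y / d x) * (1 - d y / d x * (d z / d y) + d y / d x * (d z / d y) * t)
      + (1 - d y / d x * (d z / d y)) * (1 - d y / d x + d y / d x * (d z / d y) * t)) / 2 := by
    linarith
  rcases key with key | key
  · refine not_isReachableVec_of_hasRatios (hd z) hzy hyx hs hu.le ?_ ?_ ?_ ?_ ?_ hq key
    · linarith
    · linarith
    · ring
    · linarith
    · linarith
  · refine key.ne (hq.zeroMeasure_eq (hd z) hzy hyx hs hu.le ?_ ?_).2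
    · linarith
    · linarith

end Counterexample

theorem isQuasiUniform_of_forall {Ω : Type*} {d : Ω → ℝ}
    (h : ∀ x y z : Ω, d z < d y → ¬ d y < d x) : IsQuasiUniform d := by
  rcases isEmpty_or_nonempty Ω with _ | ⟨⟨i⟩⟩
  · exact ⟨0, 0, fun i => isEmptyElim i⟩
  by_cases hj : ∃ j, d j ≠ d i
  · obtain ⟨j, hj⟩ := hj
    refine ⟨d i, d j, fun k => ?_⟩
    by_contra hk
    simp only [not_or] at hk
    rcases lt_or_gt_of_ne hj with h1 | h1 <;> rcases lt_or_gt_of_ne hk.1 with h2 | h2 <;>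
      rcases lt_or_gt_of_ne hk.2 with h3 | h3 <;>
      first
        | exact h _ _ _ h1 h2
        | exact h _ _ _ h2 h1
        | exact h _ _ _ h1 h3
        | exact h _ _ _ h3 h1
        | exact h _ _ _ h2 h3
        | exact h _ _ _ h3 h2
  · push Not at hj
    exact ⟨d i, d i, fun k => Or.inl (hj k)⟩

end ThermalOps

theorem mainTheorem6 {Ω : Type*} [Fintype Ω] [DecidableEq Ω] (d : Ω → ℝ)
    (hd : d ∈ stdSimplex ℝ Ω) (hpos : ∀ i, 0 < d i)
    (h : ThermalOps.resourceTheoryETO d = ThermalOps.resourceTheoryWETO d) :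
    ThermalOps.IsQuasiUniform d :=
  ThermalOps.isQuasiUniform_of_forall fun _ _ _ hzy hyx => by
    obtain ⟨pq, hE, hW⟩ := ThermalOps.exists_mem_ETO_notMem_WETO hpos hzy hyx
    exact hW (h ▸ hE)
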